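/- Let $F$ be a probability distribution on the whole real line $\mathbb R$. For a distribution $H$ on $\mathbb R$ write $\overline H(x)=1-H(x)=H((x,\infty))$ for its right tail. For positive functions $f,g$, $f(x)\sim g(x)$ means $\lim_{x\to\infty}f(x)/g(x)=1$. A distribution $H$ is long-tailed, $H\in\mathcal L$, if $\overline H(x)>0$ for all $x$ and $\overline H(x+1)\sim\overline H(x)$. Let $F^{*n}$ be the $n$-fold convolution of $F$ with itself ($F^{*1}=F$, and $F^{*0}$ is degenerate at $0$). Let $\tau$ be a random variable with values in $\{0,1,2,\dots\}$, put $p_n=\mathbf P(\tau=n)$ and $\overline G(x)=\mathbf P(\tau>x)$, and let $F^{*\tau}=\sum_{n=0}^\infty p_nF^{*n}$, the distribution of $X_1+\dots+X_\tau$, where $X_1,X_2,\dots$ are i.i.d. with distribution $F$ and independent of $\tau$. (1) If $F^{*n}\in\mathcal L$ for some $n\ge1$, then $F^{*k}\in\mathcal L$ for all $k\ge n$. (2) If $\sum_{k=0}^n p_k=1$ and $p_n>0$ for some $n\ge1$, then $F^{*\tau}\in\mathcal L$ if and only if $F^{*n}\in\mathcal L$. (3) If, for some $n\ge1$, $\mathbf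 P(\tau\ge n)>0$, $F^{*n}\in\mathcal L$ and, for every $a>0$, $$\lim_{x\to\infty}\frac{\overline G(ax)}{x^{1/2}\,\overline{F^{*n}}(x)}=0,$$ then $F^{*\tau}\in\mathcal L$. (4) If $L$ is a distribution on $\mathbb R$ with $F^{*2}\in\mathcal L$ and $\overline F(x)\sim\overline L(x)$ (both tails being positive), then $\overline{L^{*2}}(x)\sim\overline{F^{*2}}(x)$ and, therefore, $L^{*2}\in\mathcal L$. -/

import Mathlib

open MeasureTheory ProbabilityTheory Filter Topology
open scoped ENNReal

namespace LongTail

/-- The right tail `1 - F(x) = F((x, ∞))` of a distribution `F` on the real line. -/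
noncomputable def tail (F : Measure ℝ) (x : ℝ) : ℝ := F.real (Set.Ioi x)

theorem tail_eq_one_sub_cdf (F : Measure ℝ) [IsProbabilityMeasure F] (x : ℝ) :
    tail F x = 1 - cdf F x := by
  rw [cdf_eq_real, tail, ← Set.compl_Iic, probReal_compl_eq_one_sub measurableSet_Iic]

/-- Tail equivalence: both tails are positive functions and their ratio tends to `1`. -/
def TailEquiv (F L : Measure ℝ) : Prop :=
  (∀ x, 0 < tail F x) ∧ (∀ x, 0 < tail L x) ∧
    Tendsto (fun x : ℝ => tail F x / tail L x) atTop (𝓝 1)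

/-- The class of long-tailed distributions: the tail is a positive function and
`tail F (x + 1) ∼ tail F x` as `x → ∞`. -/
def IsLongTailed (F : Measure ℝ) : Prop :=
  (∀ x, 0 < tail F x) ∧ Tendsto (fun x : ℝ => tail F (x + 1) / tail F x) atTop (𝓝 1)

/-- The `n`-fold convolution of `F` with itself; the `0`-fold one is degenerate at zero. -/
noncomputable def convPow (F : Measure ℝ) : ℕ → Measure ℝ
  | 0 => Measure.dirac 0
  | n + 1 => (convPow F n).conv F

theorem convPow_one (F : Measure ℝ) [SFinite F] : convPow F 1 = F := by
  simp [convPow]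

instance instIsProbabilityMeasureConvPow (F : Measure ℝ) [IsProbabilityMeasure F] (n : ℕ) :
    IsProbabilityMeasure (convPow F n) := by
  induction n with
  | zero => exact Measure.dirac.isProbabilityMeasure
  | succ n ih =>
    rw [convPow]
    infer_instance

/-- The compound distribution `∑ₙ P(τ = n) F^{*n}` of a counting random variable `τ` and a
distribution `F`. By `map_randomSum` it is the distribution of a random sum of `τ` independent
random variables with distribution `F`. -/
noncomputable def compound {Ω : Type*} [MeasurableSpace Ω] (F : Measure ℝ) (P : Measure Ω)
    (τ : Ω → ℕ) : Measure ℝ :=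
  Measure.sum fun n : ℕ => P {ω | τ ω = n} • convPow F n

theorem map_partialSum {Ω : Type*} [MeasurableSpace Ω] (F : Measure ℝ)
    (P : Measure Ω) [IsProbabilityMeasure P] (X : ℕ → Ω → ℝ)
    (hX : ∀ i, Measurable (X i)) (hlaw : ∀ i, P.map (X i) = F) (hind : iIndepFun X P) (n : ℕ) :
    P.map (fun ω => ∑ i ∈ Finset.range n, X i ω) = convPow F n := by
  induction n with
  | zero => simp [convPow]
  | succ n ih =>
    have e : (∑ j ∈ Finset.range n, X j) = fun ω => ∑ i ∈ Finset.range n, X i ω := by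
      ext ω; simp
    have hi := hind.indepFun_sum_range_succ hX n
    rw [e] at hi
    have h := hi.map_add_eq_map_conv_map (Finset.measurable_sum _ fun i _ => hX i) (hX n)
    rw [convPow, ← ih, ← hlaw n, ← h]
    congr 1
    ext ω
    simp [Finset.sum_range_succ]

/-- The distribution of the random sum `X₁ + ⋯ + X_τ` of i.i.d. random variables with
distribution `F`, where `τ` is independent of them, is the compound distribution. -/
theorem map_randomSum {Ω : Type*} [MeasurableSpace Ω] (F : Measure ℝ)
    (P : Measure Ω) [IsProbabilityMeasure P] (X : ℕ → Ω → ℝ) (τ : Ω → ℕ)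
    (hX : ∀ i, Measurable (X i)) (hlaw : ∀ i, P.map (X i) = F) (hind : iIndepFun X P)
    (hτ : Measurable τ) (hτX : IndepFun τ (fun ω i => X i ω) P) :
    P.map (fun ω => ∑ i ∈ Finset.range (τ ω), X i ω) = compound F P τ := by
  have hm : ∀ n : ℕ, Measurable fun ω => ∑ i ∈ Finset.range n, X i ω := fun n =>
    Finset.measurable_sum _ fun i _ => hX i
  have hmτ : Measurable fun ω => ∑ i ∈ Finset.range (τ ω), X i ω := by
    have h2 : Measurable fun p : ℕ × Ω => ∑ i ∈ Finset.range p.1, X i p.2 :=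
      measurable_from_prod_countable_right fun n => hm n
    exact h2.comp (hτ.prodMk measurable_id)
  ext s hs
  rw [Measure.map_apply hmτ hs, compound, Measure.sum_apply _ hs]
  have hU : (fun ω => ∑ i ∈ Finset.range (τ ω), X i ω) ⁻¹' s =
      ⋃ n : ℕ, τ ⁻¹' {n} ∩ (fun ω => ∑ i ∈ Finset.range n, X i ω) ⁻¹' s := by
    ext ω; simp
  rw [hU, measure_iUnion]
  · refine tsum_congr fun n => ?_
    have hi : IndepFun τ (fun ω => ∑ i ∈ Finset.range n, X i ω) P :=
      hτX.comp (φ := id) (ψ := fun x : ℕ → ℝ => ∑ i ∈ Finset.range n, x i) measurable_id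
        (Finset.measurable_sum _ fun i _ => measurable_pi_apply i)
    rw [hi.measure_inter_preimage_eq_mul _ _ (measurableSet_singleton n) hs,
      Measure.smul_apply, smul_eq_mul, ← map_partialSum F P X hX hlaw hind n,
      Measure.map_apply (hm n) hs]
    rfl
  · intro a b hab
    refine Set.disjoint_left.2 ?_
    rintro ω ⟨h1, -⟩ ⟨h2, -⟩
    exact hab (h1.symm.trans h2)
  · exact fun n => (hτ (measurableSet_singleton n)).inter (hm n hs)

end LongTail

/-!
Write `S m` for a sum of `m` independent copies with distribution `F`. Being long-tailed means that
`P(S ∈ (x, x + 1])` is negligible with respect to `P(S > x)`, so everything is about bounding the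
mass of unit intervals.

*Higher powers.* If `S (n + 1)` lies in `(x, x + 1]`, its smallest summand is at most
`(x + 1) / (n + 1)`; given that summand, the other `n` have to fall into a unit interval far to the
right, where `F^{*n}` has a slowly decreasing tail (`convPow_succ_Ioc_le`,
`IsLongTailed.convPow_succ`).

*Lower powers.* For `k ≤ n`, a bounded perturbation by the remaining `n - k` summands shows that
`F^{*k}((x, x + 1])` is negligible with respect to the tail of `F^{*n}`, and that the tail of
`F^{*k}` is at most a constant times a shifted tail of `F^{*n}`
(`IsLongTailed.eventually_Ioc_le_of_conv`, `exists_measure_Ioi_add_le`). This settles the case of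
a bounded `τ`, in both directions.

*Unbounded `τ`.* The summands of order `k ≤ a * x` are handled by cutting `S k` into about `k / n`
blocks with long-tailed distributions. The property `SlowTail _ A ε` survives convolution with the
same `ε` and with added thresholds (`SlowTail.conv`), so `F^{*k}` has a slowly decreasing tail
beyond a threshold linear in `k` (`IsLongTailed.exists_slowTail_convPow`), which is at most `x` for
small `a`. The summands of order `k > a * x` are handled by the concentration inequality
`F^{*k}((x, x + 1]) ≤ C / √k` (`exists_convPow_Ioc_le_div_sqrt`); this is where the factor
`x ^ (1/2)` in the hypothesis comes from. The concentration inequality itself follows from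
`|φ(t)|² ≤ 1 - c t²` near `0` for the characteristic function `φ` of `F`, by integrating `|φ| ^ k`
against a compactly supported law with nonnegative characteristic function.

*Tail equivalence.* Exchanging one summand for a tail-equivalent one changes the tail of a sum by a
factor close to `1` and by the mass that the other summand gives to a window of bounded length,
which is negligible if the sum is long-tailed (`TailEquiv.conv`). Exchanging the two summands of `F^{*2}`
one after the other gives the last claim.
-/

namespace LongTail

open Set

/-! ### Convolutions of half-lines and intervals -/

theorem conv_apply (H K : Measure ℝ) [SFinite H] [SFinite K] {s : Set ℝ} (hs : MeasurableSet s) :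
    (H.conv K) s = ∫⁻ y, H ((fun x => x + y) ⁻¹' s) ∂K := by
  rw [Measure.conv, Measure.map_apply (by fun_prop) hs,
    Measure.prod_apply_symm (by measurability)]
  rfl

theorem conv_Ioi (H K : Measure ℝ) [SFinite H] [SFinite K] (x : ℝ) :
    (H.conv K) (Ioi x) = ∫⁻ y, H (Ioi (x - y)) ∂K := by
  simp [conv_apply H K measurableSet_Ioi]

theorem conv_Ioc (H K : Measure ℝ) [SFinite H] [SFinite K] (a b : ℝ) :
    (H.conv K) (Ioc a b) = ∫⁻ y, H (Ioc (a - y) (b - y)) ∂K := by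
  simp [conv_apply H K measurableSet_Ioc]

theorem mul_le_conv_of_add_mem (H K : Measure ℝ) [SFinite H] [SFinite K] {s t u : Set ℝ}
    (hu : MeasurableSet u) (h : ∀ x ∈ s, ∀ y ∈ t, x + y ∈ u) : H s * K t ≤ (H.conv K) u := by
  rw [Measure.conv, Measure.map_apply (by fun_prop) hu, ← Measure.prod_prod]
  exact measure_mono fun p hp => h _ hp.1 _ hp.2

theorem mul_le_conv_Ioi (H K : Measure ℝ) [SFinite H] [SFinite K] (x c : ℝ) :
    H (Ioi (x + c)) * K (Ioi (-c)) ≤ (H.conv K) (Ioi x) :=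
  mul_le_conv_of_add_mem H K measurableSet_Ioi fun a ha b hb => by
    simp only [mem_Ioi] at *; linarith

theorem mul_le_conv_Ioc (H K : Measure ℝ) [SFinite H] [SFinite K] (a b c : ℝ) :
    H (Ioc a b) * K (Ioc (-c) c) ≤ (H.conv K) (Ioc (a - c) (b + c)) :=
  mul_le_conv_of_add_mem H K measurableSet_Ioc fun u hu v hv => by
    simp only [mem_Ioc] at *; constructor <;> linarith

theorem exists_measure_Ioc_neg_ne_zero (K : Measure ℝ) [IsProbabilityMeasure K] :
    ∃ c : ℝ, K (Ioc (-c) c) ≠ 0 := by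
  by_contra! h
  have hU : (⋃ n : ℕ, Ioc (-(n : ℝ)) n) = univ := by
    refine eq_univ_of_forall fun x => mem_iUnion.2 ?_
    obtain ⟨n, hn⟩ := exists_nat_gt |x|
    exact ⟨n, (abs_lt.1 hn).1, (abs_lt.1 hn).2.le⟩
  have h0 : K univ = 0 := by
    rw [← hU]
    exact measure_iUnion_null fun n => h n
  simp at h0

/-- Adding an independent summand cannot destroy a right tail: up to a shift and a constant factor,
the tail of `H * K` is at least that of `H`. -/
theorem exists_measure_Ioi_add_le (H K : Measure ℝ) [SFinite H] [IsProbabilityMeasure K] :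
    ∃ (c : ℝ) (C : ℝ≥0∞), C ≠ ∞ ∧ ∀ x, H (Ioi (x + c)) ≤ C * (H.conv K) (Ioi x) := by
  obtain ⟨c, hc⟩ := exists_measure_Ioc_neg_ne_zero K
  have hc' : K (Ioi (-c)) ≠ 0 := fun h => hc (measure_mono_null Ioc_subset_Ioi_self h)
  refine ⟨c, (K (Ioi (-c)))⁻¹, ENNReal.inv_ne_top.2 hc', fun x => ?_⟩
  have h := mul_le_conv_Ioi H K x c
  rwa [mul_comm, ENNReal.mul_le_iff_le_inv hc' (measure_ne_top _ _)] at h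

theorem conv_Ioi_ne_zero {H K : Measure ℝ} [IsProbabilityMeasure H] [IsProbabilityMeasure K]
    (h : ∀ x, H (Ioi x) ≠ 0) (x : ℝ) : (H.conv K) (Ioi x) ≠ 0 := by
  obtain ⟨c, C, -, hcC⟩ := exists_measure_Ioi_add_le H K
  exact fun h0 => h (x + c) (by simpa [h0] using hcC x)

theorem convPow_add (F : Measure ℝ) [IsProbabilityMeasure F] (a b : ℕ) :
    convPow F (a + b) = (convPow F a).conv (convPow F b) := by
  induction b with
  | zero => simp [convPow]
  | succ b ih => rw [← add_assoc, convPow, ih, convPow, Measure.conv_assoc]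

theorem convPow_eq_conv_sub (F : Measure ℝ) [IsProbabilityMeasure F] {k n : ℕ} (h : k ≤ n) :
    convPow F n = (convPow F k).conv (convPow F (n - k)) := by
  rw [← convPow_add, Nat.add_sub_cancel' h]

/-! ### Long-tailedness as smallness of unit increments -/

/-- `H((x, x + 1]) = o(K((x, ∞)))` as `x → ∞`. The quantifier `ε` ranges over `ℝ≥0∞`, which spares
most conversions between measures and real numbers. -/
def NegligibleIncrements (H K : Measure ℝ) : Prop :=
  ∀ ε : ℝ≥0∞, ε ≠ 0 → ∀ᶠ x : ℝ in atTop, H (Ioc x (x + 1)) ≤ ε * K (Ioi x)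

theorem tail_pos_iff (H : Measure ℝ) [IsFiniteMeasure H] (x : ℝ) :
    0 < tail H x ↔ H (Ioi x) ≠ 0 := by
  rw [tail, measureReal_def, ENNReal.toReal_pos_iff]
  simp [pos_iff_ne_zero, measure_lt_top]

theorem tail_nonneg (H : Measure ℝ) (x : ℝ) : 0 ≤ tail H x := measureReal_nonneg

theorem tail_antitone (H : Measure ℝ) [IsFiniteMeasure H] : Antitone (tail H) :=
  fun _ _ h => measureReal_mono (Ioi_subset_Ioi h)

theorem ofReal_tail (H : Measure ℝ) [IsFiniteMeasure H] (x : ℝ) :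
    ENNReal.ofReal (tail H x) = H (Ioi x) := by
  simp [tail]

theorem measureReal_Ioc_eq_tail_sub (H : Measure ℝ) [IsFiniteMeasure H] {a b : ℝ} (h : a ≤ b) :
    H.real (Ioc a b) = tail H a - tail H b := by
  rw [tail, tail, ← Ioc_union_Ioi_eq_Ioi h,
    measureReal_union (Ioc_disjoint_Ioi le_rfl) measurableSet_Ioi]
  ring

theorem IsLongTailed.tendsto_add_nat {H : Measure ℝ} (hH : IsLongTailed H) (n : ℕ) :
    Tendsto (fun x => tail H (x + n) / tail H x) atTop (𝓝 1) := by
  induction n with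
  | zero =>
    simp only [Nat.cast_zero, add_zero, div_self (hH.1 _).ne']
    exact tendsto_const_nhds
  | succ n ih =>
    have h := (hH.2.comp (tendsto_atTop_add_const_right atTop (n : ℝ) tendsto_id)).mul ih
    simp only [mul_one] at h
    refine h.congr fun x => ?_
    have := (hH.1 (x + n)).ne'
    simp only [Function.comp, id]
    push_cast
    rw [div_mul_div_cancel₀ this, add_assoc]

theorem IsLongTailed.tendsto_add {H : Measure ℝ} [IsFiniteMeasure H] (hH : IsLongTailed H) (c : ℝ) :
    Tendsto (fun x => tail H (x + c) / tail H x) atTop (𝓝 1) := by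
  have key : ∀ c : ℝ, 0 ≤ c → Tendsto (fun x => tail H (x + c) / tail H x) atTop (𝓝 1) := by
    intro c hc
    obtain ⟨n, hn⟩ := exists_nat_ge c
    refine tendsto_of_tendsto_of_tendsto_of_le_of_le (hH.tendsto_add_nat n) tendsto_const_nhds
      (fun x => ?_) fun x => ?_
    · exact div_le_div_of_nonneg_right (tail_antitone H (by linarith)) (hH.1 x).le
    · exact div_le_one_of_le₀ (tail_antitone H (by linarith)) (hH.1 x).le
  rcases le_total 0 c with hc | hc
  · exact key c hc
  · have h := (((key (-c) (by linarith)).comp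
      (tendsto_atTop_add_const_right atTop c tendsto_id))).inv₀ one_ne_zero
    simpa [Function.comp_def] using h

theorem IsLongTailed.eventually_Ioc_le {H : Measure ℝ} [IsFiniteMeasure H] (hH : IsLongTailed H)
    (a b : ℝ) {ε : ℝ≥0∞} (hε : ε ≠ 0) :
    ∀ᶠ x : ℝ in atTop, H (Ioc (x + a) (x + b)) ≤ ε * H (Ioi x) := by
  rcases le_total b a with hab | hab
  · simp [hab]
  rcases eq_or_ne ε ∞ with rfl | hε'
  · refine Eventually.of_forall fun x => ?_
    rw [ENNReal.top_mul ((tail_pos_iff H x).1 (hH.1 x))]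
    exact le_top
  have h := (hH.tendsto_add a).sub (hH.tendsto_add b)
  rw [sub_self] at h
  filter_upwards [h.eventually_lt_const (ENNReal.toReal_pos hε hε')] with x hx
  rw [← sub_div, ← measureReal_Ioc_eq_tail_sub H (by linarith), div_lt_iff₀ (hH.1 x)] at hx
  rw [← ofReal_measureReal (μ := H) (s := Ioc _ _), ← ofReal_tail, ← ENNReal.ofReal_toReal hε',
    ← ENNReal.ofReal_mul ENNReal.toReal_nonneg]
  exact ENNReal.ofReal_le_ofReal hx.le

theorem IsLongTailed.eventually_Ioi_le {H : Measure ℝ} [IsFiniteMeasure H] (hH : IsLongTailed H)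
    (c : ℝ) : ∀ᶠ x : ℝ in atTop, H (Ioi x) ≤ 2 * H (Ioi (x + c)) := by
  filter_upwards [(hH.tendsto_add c).eventually_const_lt (by norm_num : (1 / 2 : ℝ) < 1)] with x hx
  rw [lt_div_iff₀ (hH.1 x)] at hx
  rw [← ofReal_tail, ← ofReal_tail, ← ENNReal.ofReal_ofNat, ← ENNReal.ofReal_mul (by norm_num)]
  exact ENNReal.ofReal_le_ofReal (by linarith)

theorem isLongTailed_iff (H : Measure ℝ) [IsFiniteMeasure H] :
    IsLongTailed H ↔ (∀ x, H (Ioi x) ≠ 0) ∧ NegligibleIncrements H H := by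
  refine ⟨fun h => ⟨fun x => (tail_pos_iff H x).1 (h.1 x), fun ε hε => ?_⟩, fun h => ?_⟩
  · simpa using h.eventually_Ioc_le 0 1 hε
  have hp : ∀ x, 0 < tail H x := fun x => (tail_pos_iff H x).2 (h.1 x)
  refine ⟨hp, ?_⟩
  rw [Metric.tendsto_nhds]
  intro ε hε
  filter_upwards [h.2 (ENNReal.ofReal (ε / 2)) (by simpa using hε)] with x hx
  rw [← ofReal_measureReal (μ := H) (s := Ioc _ _), ← ofReal_tail,
    ← ENNReal.ofReal_mul (by positivity),
    ENNReal.ofReal_le_ofReal_iff (mul_nonneg (by positivity) (hp x).le),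
    measureReal_Ioc_eq_tail_sub H (by linarith)] at hx
  have h1 : tail H (x + 1) ≤ tail H x := tail_antitone H (by linarith)
  rw [Real.dist_eq, div_sub_one (hp x).ne', abs_div, abs_of_pos (hp x), div_lt_iff₀ (hp x),
    abs_sub_comm, abs_of_nonneg (by linarith)]
  nlinarith [hp x]

theorem NegligibleIncrements.mono {H K M : Measure ℝ} {C : ℝ≥0∞} (hC : C ≠ ∞)
    (h : NegligibleIncrements H K) (hKM : ∀ᶠ x in atTop, K (Ioi x) ≤ C * M (Ioi x)) :
    NegligibleIncrements H M := by
  intro ε hε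
  filter_upwards [h (ε / C) (ENNReal.div_ne_zero.2 ⟨hε, hC⟩), hKM] with x h1 h2
  refine h1.trans ((mul_le_mul_right h2 _).trans ?_)
  rw [← mul_assoc]
  exact mul_le_mul_left ((mul_comm _ _).trans_le ENNReal.mul_div_le) _

/-- If `H * K` is long-tailed, then the mass of `H` on intervals of bounded length is negligible
with respect to the tail of `H * K`. No tail condition on `H` is needed: shifting an interval by a
bounded amount gives an interval of bounded length, so the mass is seen by `H * K`. -/
theorem IsLongTailed.eventually_Ioc_le_of_conv {H K : Measure ℝ} [IsProbabilityMeasure H]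
    [IsProbabilityMeasure K] (h : IsLongTailed (H.conv K)) (a b : ℝ) {ε : ℝ≥0∞} (hε : ε ≠ 0) :
    ∀ᶠ x : ℝ in atTop, H (Ioc (x + a) (x + b)) ≤ ε * (H.conv K) (Ioi x) := by
  obtain ⟨c, hc⟩ := exists_measure_Ioc_neg_ne_zero K
  filter_upwards [h.eventually_Ioc_le (a - c) (b + c)
    (mul_ne_zero hε hc)] with x hx
  have h1 := (mul_le_conv_Ioc H K (x + a) (x + b) c).trans
    (by simpa only [add_sub_assoc, add_assoc] using hx)
  rw [mul_right_comm] at h1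
  exact (ENNReal.mul_le_mul_iff_left hc (measure_ne_top _ _)).1 h1

theorem IsLongTailed.negligibleIncrements_of_conv {H K : Measure ℝ} [IsProbabilityMeasure H]
    [IsProbabilityMeasure K] (h : IsLongTailed (H.conv K)) :
    NegligibleIncrements H (H.conv K) := fun ε hε => by
  simpa using h.eventually_Ioc_le_of_conv 0 1 hε

/-! ### Slowly decreasing tails and convolution -/

/-- Beyond the threshold `A`, the mass of `(x, x + 1]` is at most the fraction `ε` of the mass of
`(x, ∞)`. -/
def SlowTail (H : Measure ℝ) (A : ℝ) (ε : ℝ≥0∞) : Prop :=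
  ∀ x, A ≤ x → H (Ioc x (x + 1)) ≤ ε * H (Ioi x)

theorem SlowTail.mono {H : Measure ℝ} {A B : ℝ} {ε : ℝ≥0∞} (h : SlowTail H A ε) (hAB : A ≤ B) :
    SlowTail H B ε := fun x hx => h x (hAB.trans hx)

theorem SlowTail.restrict_Ioi {H : Measure ℝ} {A : ℝ} {ε : ℝ≥0∞} (h : SlowTail H A ε) (x : ℝ) :
    H.restrict (Ioi A) (Ioc x (x + 1)) ≤ ε * H.restrict (Ioi A) (Ioi x) := by
  rw [Measure.restrict_apply measurableSet_Ioc, Measure.restrict_apply measurableSet_Ioi,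
    Ioi_inter_Ioi]
  refine le_trans (measure_mono fun y hy => ?_) (h (x ⊔ A) le_sup_right)
  simp only [mem_inter_iff, mem_Ioc, mem_Ioi] at hy
  exact ⟨sup_lt_iff.2 ⟨hy.1.1, hy.2⟩, hy.1.2.trans (by gcongr; exact le_sup_left)⟩

/-- Thresholds add up under convolution while `ε` stays the same: when the sum exceeds
`A + B` and the second summand exceeds its threshold, the bound for it is used, conditionally on the first summand; otherwise the first summand
exceeds its own threshold. -/
theorem SlowTail.conv {H K : Measure ℝ} [SFinite H] [SFinite K] {A B : ℝ} {ε : ℝ≥0∞}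
    (hε : ε ≠ ∞) (hH : SlowTail H A ε) (hK : SlowTail K B ε) : SlowTail (H.conv K) (A + B) ε := by
  intro x hx
  have hsplit : H.conv K = H.conv (K.restrict (Iic B)) + (K.restrict (Ioi B)).conv H := by
    rw [Measure.conv_comm (K.restrict (Ioi B)) H, ← Measure.conv_add, ← compl_Iic,
      Measure.restrict_add_restrict_compl measurableSet_Iic]
  rw [hsplit, Measure.add_apply, Measure.add_apply, mul_add]
  simp only [conv_Ioi, conv_Ioc]
  rw [← lintegral_const_mul' _ _ hε, ← lintegral_const_mul' _ _ hε]
  gcongr ?_ + ?_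
  · refine setLIntegral_mono' measurableSet_Iic fun y hy => ?_
    have := hH (x - y) (by simp only [mem_Iic] at hy; linarith)
    rwa [sub_add_eq_add_sub] at this
  · refine lintegral_mono fun y => ?_
    have := hK.restrict_Ioi (x - y)
    rwa [sub_add_eq_add_sub] at this

theorem IsLongTailed.exists_slowTail {H : Measure ℝ} [IsFiniteMeasure H] (h : IsLongTailed H)
    {ε : ℝ≥0∞} (hε : ε ≠ 0) : ∃ A, SlowTail H A ε :=
  eventually_atTop.1 (((isLongTailed_iff H).1 h).2 ε hε)

/-! ### Convolution powers of higher order -/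

theorem measurable_finsetSum {Ω : Type*} [MeasurableSpace Ω] {X : ℕ → Ω → ℝ}
    (hX : ∀ i, Measurable (X i)) (s : Finset ℕ) : Measurable (∑ i ∈ s, X i) := by
  have h : Measurable fun ω => ∑ i ∈ s, X i ω := Finset.measurable_sum _ fun i _ => hX i
  simpa only [← Finset.sum_apply] using h

theorem map_finsetSum {Ω : Type*} [MeasurableSpace Ω] (F : Measure ℝ)
    (P : Measure Ω) [IsProbabilityMeasure P] (X : ℕ → Ω → ℝ)
    (hX : ∀ i, Measurable (X i)) (hlaw : ∀ i, P.map (X i) = F) (hind : iIndepFun X P)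
    (s : Finset ℕ) : P.map (∑ i ∈ s, X i) = convPow F s.card := by
  induction s using Finset.induction_on with
  | empty => simp [convPow, Pi.zero_def]
  | insert a s ha ih =>
    rw [Finset.sum_insert ha, add_comm, Finset.card_insert_of_notMem ha, convPow, ← ih,
      ← hlaw a]
    exact (hind.indepFun_finsetSum_of_notMem hX ha).map_add_eq_map_conv_map
      (measurable_finsetSum hX _) (hX a)

/-- If a sum of `n + 1` independent copies lies in `(x, x + 1]`, then one of the summands is at most
`(x + 1) / (n + 1)`, and by exchangeability it may be taken to be the last one. -/
theorem convPow_succ_Ioc_le (F : Measure ℝ) [IsProbabilityMeasure F] (n : ℕ) (x : ℝ) :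
    convPow F (n + 1) (Ioc x (x + 1)) ≤ (n + 1 : ℕ) *
      ∫⁻ y in Iic ((x + 1) / (n + 1)), convPow F n (Ioc (x - y) (x + 1 - y)) ∂F := by
  set Q : Measure (ℕ → ℝ) := Measure.infinitePi fun _ => F
  set X : ℕ → (ℕ → ℝ) → ℝ := fun i ω => ω i
  have hX : ∀ i, Measurable (X i) := fun i => measurable_pi_apply i
  have hlaw : ∀ i, Q.map (X i) = F := fun i => Measure.infinitePi_map_eval _ i
  have hind : iIndepFun X Q := iIndepFun_infinitePi (X := fun _ y => y) fun _ => measurable_id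
  set c := (x + 1) / ((n : ℝ) + 1)
  have hT : ∀ i, Measurable (∑ j ∈ (Finset.range (n + 1)).erase i, X j) := fun i =>
    measurable_finsetSum hX _
  set D : Set (ℝ × ℝ) := {p | p.1 + p.2 ∈ Ioc x (x + 1) ∧ p.2 ≤ c}
  have hD : MeasurableSet D :=
    ((measurable_fst.add measurable_snd) measurableSet_Ioc).inter
      (measurable_snd measurableSet_Iic)
  have hmain : ∀ i ∈ Finset.range (n + 1),
      Q ((fun ω => ((∑ j ∈ (Finset.range (n + 1)).erase i, X j) ω, X i ω)) ⁻¹' D) =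
      ∫⁻ y in Iic c, convPow F n (Ioc (x - y) (x + 1 - y)) ∂F := by
    intro i hi
    have hpair := (indepFun_iff_map_prod_eq_prod_map_map (hT i).aemeasurable
      (hX i).aemeasurable).1 (hind.indepFun_finsetSum_of_notMem hX (Finset.notMem_erase i _))
    rw [map_finsetSum F Q X hX hlaw hind, hlaw, Finset.card_erase_of_mem hi,
      Finset.card_range, Nat.add_sub_cancel] at hpair
    rw [← Measure.map_apply ((hT i).prodMk (hX i)) hD, hpair, Measure.prod_apply_symm hD,
      ← lintegral_indicator measurableSet_Iic]
    refine lintegral_congr fun y => ?_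
    by_cases hy : y ≤ c
    · rw [indicator_of_mem (by exact hy)]
      congr 1
      ext z
      simp [D, hy, sub_lt_iff_lt_add, le_sub_iff_add_le]
    · rw [indicator_of_notMem (by exact hy)]
      have : (fun z => (z, y)) ⁻¹' D = ∅ := by
        ext z
        simp [D, hy]
      rw [this, measure_empty]
  calc convPow F (n + 1) (Ioc x (x + 1))
      = Q ((∑ j ∈ Finset.range (n + 1), X j) ⁻¹' Ioc x (x + 1)) := by
        rw [← Measure.map_apply (measurable_finsetSum hX _) measurableSet_Ioc,
          map_finsetSum F Q X hX hlaw hind, Finset.card_range]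
    _ ≤ Q (⋃ i ∈ Finset.range (n + 1),
          (fun ω => ((∑ j ∈ (Finset.range (n + 1)).erase i, X j) ω, X i ω)) ⁻¹' D) := by
        refine measure_mono fun ω hω => ?_
        obtain ⟨i, hi, hic⟩ : ∃ i ∈ Finset.range (n + 1), X i ω ≤ c := by
          refine Finset.exists_le_of_sum_le (by simp) ?_
          have h1 := hω.2
          rw [Finset.sum_apply] at h1
          refine h1.trans_eq ?_
          rw [Finset.sum_const, Finset.card_range, nsmul_eq_mul]
          push_cast
          exact (mul_div_cancel₀ _ (by positivity)).symm
        refine mem_biUnion hi ⟨?_, hic⟩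
        have : (∑ j ∈ (Finset.range (n + 1)).erase i, X j) ω + X i ω =
            (∑ j ∈ Finset.range (n + 1), X j) ω := by
          rw [← Finset.sum_erase_add _ _ hi, Pi.add_apply]
        exact this.symm ▸ hω
    _ ≤ ∑ i ∈ Finset.range (n + 1),
          Q ((fun ω => ((∑ j ∈ (Finset.range (n + 1)).erase i, X j) ω, X i ω)) ⁻¹' D) :=
        measure_biUnion_finset_le _ _
    _ = _ := by rw [Finset.sum_congr rfl hmain, Finset.sum_const, Finset.card_range, nsmul_eq_mul]

theorem IsLongTailed.convPow_succ {F : Measure ℝ} [IsProbabilityMeasure F] {n : ℕ} (hn : 1 ≤ n)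
    (h : IsLongTailed (convPow F n)) : IsLongTailed (convPow F (n + 1)) := by
  rw [isLongTailed_iff] at h ⊢
  have hpos : ∀ x, convPow F (n + 1) (Ioi x) ≠ 0 := conv_Ioi_ne_zero h.1
  refine ⟨hpos, fun ε hε => ?_⟩
  rcases eq_or_ne ε ∞ with rfl | hε'
  · refine Eventually.of_forall fun x => ?_
    rw [ENNReal.top_mul (hpos x)]
    exact le_top
  have hδ : ε / (n + 1 : ℕ) ≠ 0 := ENNReal.div_ne_zero.2 ⟨hε, ENNReal.natCast_ne_top _⟩
  have hδ' : ε / (n + 1 : ℕ) ≠ ∞ := ENNReal.div_ne_top hε' (by simp)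
  obtain ⟨A, hA⟩ := eventually_atTop.1 (h.2 _ hδ)
  filter_upwards [eventually_ge_atTop (2 * |A| + 1)] with x hx
  have hy : ∀ y ≤ (x + 1) / ((n : ℝ) + 1), A ≤ x - y := by
    intro y hy
    have hx0 : 0 ≤ x + 1 := by linarith [abs_nonneg A]
    have : (x + 1) / ((n : ℝ) + 1) ≤ (x + 1) / 2 := by
      gcongr
      have : (1 : ℝ) ≤ n := by exact_mod_cast hn
      linarith
    linarith [le_abs_self A]
  calc convPow F (n + 1) (Ioc x (x + 1))
      ≤ (n + 1 : ℕ) *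
        ∫⁻ y in Iic ((x + 1) / (n + 1)), convPow F n (Ioc (x - y) (x + 1 - y)) ∂F :=
        convPow_succ_Ioc_le F n x
    _ ≤ (n + 1 : ℕ) * ∫⁻ y in Iic ((x + 1) / ((n : ℝ) + 1)),
          ε / (n + 1 : ℕ) * convPow F n (Ioi (x - y)) ∂F := by
        refine mul_le_mul_right ?_ _
        refine setLIntegral_mono' measurableSet_Iic fun y hyc => ?_
        have := hA (x - y) (hy y hyc)
        rwa [sub_add_eq_add_sub] at this
    _ ≤ (n + 1 : ℕ) * (ε / (n + 1 : ℕ) * convPow F (n + 1) (Ioi x)) := by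
        rw [lintegral_const_mul' _ _ hδ']
        change _ ≤ _ * (_ * ((convPow F n).conv F) (Ioi x))
        rw [conv_Ioi]
        refine mul_le_mul_right (mul_le_mul_right ?_ _) _
        exact setLIntegral_le_lintegral _ _
    _ = ε * convPow F (n + 1) (Ioi x) := by
        rw [← mul_assoc, ENNReal.mul_div_cancel (by simp) (ENNReal.natCast_ne_top _)]

theorem IsLongTailed.convPow_of_le {F : Measure ℝ} [IsProbabilityMeasure F] {n : ℕ} (hn : 1 ≤ n)
    (h : IsLongTailed (convPow F n)) {k : ℕ} (hk : n ≤ k) : IsLongTailed (convPow F k) := by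
  induction k, hk using Nat.le_induction with
  | base => exact h
  | succ k hk ih => exact ih.convPow_succ (hn.trans hk)

/-- A sum of `m ≥ n` copies splits into `m / n` independent blocks of between `n` and `2 * n - 1`
summands. Each block has a slowly decreasing tail, with a common threshold `A > 0`, so the threshold
for the sum grows only linearly in `m`. -/
theorem IsLongTailed.exists_slowTail_convPow {F : Measure ℝ} [IsProbabilityMeasure F] {n : ℕ}
    (hn : 1 ≤ n) (h : IsLongTailed (convPow F n)) {ε : ℝ≥0∞} (hε : ε ≠ 0) (hε' : ε ≠ ∞) :
    ∃ A : ℝ, 0 < A ∧ ∀ m, n ≤ m → SlowTail (convPow F m) (m * A) ε := by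
  have h1 : ∀ r : ℕ, ∃ A, SlowTail (convPow F (n + r)) A ε := fun r =>
    (h.convPow_of_le hn (Nat.le_add_right n r)).exists_slowTail hε
  choose B hB using h1
  -- The block sizes `n + r` with `r < n` suffice to write every `m ≥ n` as a sum.
  set A := 1 + ∑ r ∈ Finset.range n, |B r|
  have hA0 : 0 < A := by positivity
  have hA : ∀ r < n, SlowTail (convPow F (n + r)) A ε := fun r hr => by
    refine (hB r).mono ((le_abs_self _).trans ?_)
    have := Finset.single_le_sum (f := fun r => |B r|) (fun i _ => abs_nonneg _)
      (Finset.mem_range.2 hr)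
    simp only [A]
    linarith
  refine ⟨A, hA0, fun m hm => ?_⟩
  induction m using Nat.strong_induction_on with
  | _ m ih =>
    rcases lt_or_ge m (2 * n) with hlt | hge
    · have := hA (m - n) (by omega)
      rw [Nat.add_sub_cancel' hm] at this
      refine this.mono ?_
      have : (1 : ℝ) ≤ m := by exact_mod_cast hn.trans hm
      nlinarith
    · have h2 := (ih (m - n) (by omega) (by omega)).conv hε' (hA 0 (by omega))
      rw [add_zero, ← convPow_add, Nat.sub_add_cancel hm] at h2
      refine h2.mono ?_
      have : (n : ℝ) ≤ m := by exact_mod_cast hm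
      have : (1 : ℝ) ≤ n := by exact_mod_cast hn
      rw [Nat.cast_sub hm]
      nlinarith

/-! ### A concentration inequality for convolution powers -/

/-- The law of `V - V'` for independent `V`, `V'` uniformly distributed on `[0, 1]`. Its
characteristic function is nonnegative, being the squared modulus of that of `V`, and it serves as
a smooth majorant of an interval around `0`. -/
noncomputable def triangleLaw : Measure ℝ :=
  (volume.restrict (Icc (0 : ℝ) 1)).conv ((volume.restrict (Icc (0 : ℝ) 1)).map (-1 * ·))

instance isProbabilityMeasure_unitInterval :
    IsProbabilityMeasure (volume.restrict (Icc (0 : ℝ) 1)) := ⟨by simp⟩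

instance isProbabilityMeasure_map_neg (H : Measure ℝ) [IsProbabilityMeasure H] :
    IsProbabilityMeasure (H.map (-1 * ·)) :=
  Measure.isProbabilityMeasure_map (by fun_prop)

instance isProbabilityMeasure_triangleLaw : IsProbabilityMeasure triangleLaw := by
  unfold triangleLaw
  infer_instance

/-- The characteristic function of a symmetrized distribution. -/
theorem charFun_conv_map_neg (H : Measure ℝ) [IsProbabilityMeasure H] (t : ℝ) :
    charFun (H.conv (H.map (-1 * ·))) t = ((‖charFun H t‖ ^ 2 : ℝ) : ℂ) := by
  rw [charFun_conv, charFun_map_mul, neg_one_mul, charFun_neg, Complex.mul_conj,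
    Complex.normSq_eq_norm_sq]

theorem triangleLaw_le_volume : triangleLaw ≤ volume := by
  refine Measure.le_intro fun s hs _ => ?_
  rw [triangleLaw, conv_apply _ _ hs]
  refine (lintegral_mono fun y => (?_ : _ ≤ volume s)).trans_eq
    (by rw [lintegral_const, measure_univ, mul_one])
  exact (Measure.restrict_apply_le _ _).trans_eq (measure_preimage_add_right volume y s)

theorem ae_triangleLaw_abs_le : ∀ᵐ t ∂triangleLaw, |t| ≤ 1 := by
  have h1 : ∀ᵐ x ∂(volume.restrict (Icc (0 : ℝ) 1)), x ∈ Icc (0 : ℝ) 1 :=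
    ae_restrict_mem measurableSet_Icc
  have h2 : ∀ᵐ x ∂((volume.restrict (Icc (0 : ℝ) 1)).map (-1 * ·)), x ∈ Icc (-1 : ℝ) 0 := by
    refine (ae_map_iff (by fun_prop) measurableSet_Icc).2 ?_
    filter_upwards [h1] with x hx
    constructor <;> linarith [hx.1, hx.2]
  have hs : MeasurableSet {t : ℝ | |t| ≤ 1} := measurableSet_le (by fun_prop) (by fun_prop)
  rw [triangleLaw, Measure.conv, ae_map_iff (by fun_prop) hs]
  filter_upwards [Measure.quasiMeasurePreserving_fst.ae h1,
    Measure.quasiMeasurePreserving_snd.ae h2] with p hp1 hp2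
  rw [abs_le]
  constructor <;> linarith [hp1.1, hp1.2, hp2.1, hp2.2]

theorem integrable_cos_mul (H : Measure ℝ) [IsFiniteMeasure H] (t : ℝ) :
    Integrable (fun x => Real.cos (t * x)) H :=
  (integrable_const (1 : ℝ)).mono (by fun_prop)
    (ae_of_all _ fun x => by simpa using Real.abs_cos_le_one _)

theorem re_charFun (H : Measure ℝ) [IsFiniteMeasure H] (t : ℝ) :
    (charFun H t).re = ∫ x, Real.cos (t * x) ∂H := by
  rw [charFun_apply_real, ← RCLike.re_eq_complex_re, ← integral_re]
  · refine integral_congr_ae (ae_of_all _ fun x => ?_)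
    simp only [RCLike.re_eq_complex_re]
    rw [← Complex.ofReal_mul, Complex.exp_ofReal_mul_I_re]
  · refine (integrable_const (1 : ℝ)).mono (by fun_prop) (ae_of_all _ fun x => ?_)
    rw [← Complex.ofReal_mul, Complex.norm_exp_ofReal_mul_I]
    simp

theorem half_le_norm_charFun_unitInterval {u : ℝ} (hu : |u| ≤ 1) :
    1 / 2 ≤ ‖charFun (volume.restrict (Icc (0 : ℝ) 1)) u‖ := by
  refine le_trans ?_ ((le_abs_self _).trans (Complex.abs_re_le_norm _))
  rw [re_charFun]
  calc (1 / 2 : ℝ) = ∫ _ in Icc (0 : ℝ) 1, (1 / 2 : ℝ) := by simp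
    _ ≤ _ := by
      refine setIntegral_mono_on (by simp) (integrable_cos_mul _ _) measurableSet_Icc fun x hx => ?_
      have h1 : |u * x| ≤ 1 := by
        rw [abs_mul, abs_of_nonneg hx.1]
        exact mul_le_one₀ hu hx.1 hx.2
      have h2 : (u * x) ^ 2 ≤ 1 := (sq_le_one_iff_abs_le_one _).2 h1
      linarith [Real.one_sub_sq_div_two_le_cos (x := u * x)]

theorem integral_charFun_comm (H K : Measure ℝ) [IsFiniteMeasure H] [IsFiniteMeasure K] :
    ∫ x, charFun K x ∂H = ∫ t, charFun H t ∂K := by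
  simp only [charFun_apply_real]
  rw [integral_integral_swap]
  · refine integral_congr_ae (ae_of_all _ fun x => integral_congr_ae (ae_of_all _ fun y => ?_))
    simp only [mul_comm]
  · refine (integrable_const (1 : ℝ)).mono (by fun_prop) (ae_of_all _ fun x => ?_)
    rw [Function.uncurry, ← Complex.ofReal_mul, Complex.norm_exp_ofReal_mul_I]
    simp

/-- The mass of a unit interval is controlled by the characteristic function near `0`: the
characteristic function of `triangleLaw` is nonnegative and at least `1 / 4` on `[0, 1]`, and its
integral is turned into one of the characteristic function of `H` by Fubini. The scale `δ` restricts
the range of the characteristic function of `H` to `[-δ, δ]`. -/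
theorem measureReal_Ioc_le_integral_norm_charFun (H : Measure ℝ) [IsProbabilityMeasure H] {δ : ℝ}
    (hδ : 0 ≤ δ) (hδ1 : δ ≤ 1) (x : ℝ) :
    H.real (Ioc x (x + 1)) ≤ 4 * ∫ t, ‖charFun H (δ * t)‖ ∂triangleLaw := by
  set U := volume.restrict (Icc (0 : ℝ) 1)
  set H' : Measure ℝ := (H.map (· + -x)).map (δ * ·)
  have : IsProbabilityMeasure (H.map (· + -x)) :=
    Measure.isProbabilityMeasure_map (by fun_prop)
  have : IsProbabilityMeasure H' := Measure.isProbabilityMeasure_map (by fun_prop)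
  have hH' : ∀ t, ‖charFun H' t‖ = ‖charFun H (δ * t)‖ := fun t => by
    rw [charFun_map_mul, charFun_map_add_const, norm_mul]
    simp [Complex.norm_exp]
  have hsub : H.real (Ioc x (x + 1)) ≤ H'.real (Icc 0 1) := by
    rw [map_measureReal_apply (by fun_prop) measurableSet_Icc,
      map_measureReal_apply (by fun_prop) ((measurable_const_mul δ) measurableSet_Icc)]
    refine measureReal_mono fun y hy => ?_
    simp only [mem_preimage, mem_Icc, mem_Ioc] at *
    exact ⟨mul_nonneg hδ (by linarith), mul_le_one₀ hδ1 (by linarith) (by linarith)⟩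
  have hint : Integrable (fun u => 4 * ‖charFun U u‖ ^ 2) H' := by
    refine (integrable_const (4 : ℝ)).mono (by fun_prop) (ae_of_all _ fun u => ?_)
    have h1 : ‖charFun U u‖ ≤ 1 := norm_charFun_le_one _
    rw [Real.norm_of_nonneg (by positivity), Real.norm_of_nonneg (by norm_num)]
    nlinarith [norm_nonneg (charFun U u)]
  calc H.real (Ioc x (x + 1)) ≤ H'.real (Icc 0 1) := hsub
    _ = ∫ u, (Icc (0 : ℝ) 1).indicator 1 u ∂H' := (integral_indicator_one measurableSet_Icc).symm
    _ ≤ ∫ u, 4 * ‖charFun U u‖ ^ 2 ∂H' := by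
        refine integral_mono ((integrable_const (1 : ℝ)).indicator measurableSet_Icc) hint
          (indicator_le' (fun u hu => ?_) fun u _ => by positivity)
        have := half_le_norm_charFun_unitInterval (abs_le.2 ⟨by linarith [hu.1], hu.2⟩)
        simp only [Pi.one_apply]
        nlinarith
    _ = 4 * ‖∫ u, charFun triangleLaw u ∂H'‖ := by
        simp only [triangleLaw, charFun_conv_map_neg]
        rw [integral_complex_ofReal, integral_const_mul, Complex.norm_of_nonneg]
        exact integral_nonneg fun u => by positivity
    _ ≤ 4 * ∫ t, ‖charFun H (δ * t)‖ ∂triangleLaw := by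
        rw [integral_charFun_comm]
        gcongr
        simpa only [hH'] using norm_integral_le_integral_norm (μ := triangleLaw) (charFun H')

/-- If the right tail of `F` is everywhere positive, then the symmetrization of `F` charges some
bounded set away from `0`, so that `1 - |φ(t)|²` is at least of order `t²` near `0`. -/
theorem exists_norm_charFun_sq_le (F : Measure ℝ) [IsProbabilityMeasure F]
    (hF : ∀ x, F (Ioi x) ≠ 0) : ∃ δ c : ℝ, 0 ≤ δ ∧ δ ≤ 1 ∧ 0 < c ∧
      ∀ t : ℝ, |t| ≤ 1 → ‖charFun F (δ * t)‖ ^ 2 ≤ 1 - c * t ^ 2 := by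
  set D := F.conv (F.map (-1 * ·))
  obtain ⟨N, hN⟩ : ∃ N : ℕ, D (Ioc 1 (N : ℝ)) ≠ 0 := by
    by_contra! h
    have hU : (⋃ n : ℕ, Ioc (1 : ℝ) n) = Ioi 1 := by
      ext x
      simp only [mem_iUnion, mem_Ioc, mem_Ioi, exists_and_left, and_iff_left_iff_imp]
      exact fun _ => exists_nat_ge x
    refine (conv_Ioi_ne_zero hF 1 : D (Ioi 1) ≠ 0) ?_
    rw [← hU]
    exact measure_iUnion_null h
  have hN1 : (1 : ℝ) < N := by
    by_contra! h
    simp [Ioc_eq_empty_of_le h] at hN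
  set p := D.real (Ioc 1 (N : ℝ))
  have hp : 0 < p := ENNReal.toReal_pos hN (measure_ne_top _ _)
  set δ : ℝ := (N : ℝ)⁻¹
  have hδ : 0 < δ := by positivity
  refine ⟨δ, 2 / Real.pi ^ 2 * δ ^ 2 * p, hδ.le, inv_le_one_of_one_le₀ hN1.le,
    by positivity, fun t ht => ?_⟩
  have h1 : ‖charFun F (δ * t)‖ ^ 2 = ∫ y, Real.cos (δ * t * y) ∂D := by
    rw [← re_charFun, charFun_conv_map_neg, Complex.ofReal_re]
  have hint : Integrable ((Ioc (1 : ℝ) N).indicator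
      fun _ => 2 / Real.pi ^ 2 * (δ * t) ^ 2) D :=
    (integrable_const _).indicator measurableSet_Ioc
  calc ‖charFun F (δ * t)‖ ^ 2 = ∫ y, Real.cos (δ * t * y) ∂D := h1
    _ ≤ ∫ y, (1 - (Ioc (1 : ℝ) N).indicator (fun _ => 2 / Real.pi ^ 2 * (δ * t) ^ 2) y) ∂D := by
        refine integral_mono (integrable_cos_mul _ _) ((integrable_const _).sub hint) fun y => ?_
        by_cases hy : y ∈ Ioc (1 : ℝ) N
        · simp only [indicator_of_mem hy]
          have hy0 : (0 : ℝ) < y := by linarith [hy.1]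
          have h2 : |δ * t * y| ≤ Real.pi := by
            rw [abs_mul, abs_mul, abs_of_pos hδ, abs_of_pos hy0]
            have h3 : δ * y ≤ 1 := by
              rw [inv_mul_le_iff₀ (by linarith)]
              linarith [hy.2]
            nlinarith [Real.pi_gt_three, abs_nonneg t, mul_pos hδ hy0]
          refine (Real.cos_le_one_sub_mul_cos_sq h2).trans ?_
          have h4 : (δ * t) ^ 2 ≤ (δ * t * y) ^ 2 := by
            rw [mul_pow (δ * t) y]
            exact le_mul_of_one_le_right (sq_nonneg _) (one_le_pow₀ hy.1.le)
          gcongr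
        · simp only [indicator_of_notMem hy, sub_zero]
          exact Real.cos_le_one _
    _ = 1 - 2 / Real.pi ^ 2 * δ ^ 2 * p * t ^ 2 := by
        rw [integral_sub (integrable_const _) hint, integral_indicator_const _ measurableSet_Ioc]
        simp only [integral_const, probReal_univ, smul_eq_mul, p]
        ring

/-- A case of the Kolmogorov–Rogozin inequality. The bound `exp (-m c t² / 2)` for the modulus of
the characteristic function is integrated over the whole line, as `triangleLaw` has a density at most
`1`. -/
theorem exists_convPow_Ioc_le_div_sqrt (F : Measure ℝ) [IsProbabilityMeasure F]
    (hF : ∀ x, F (Ioi x) ≠ 0) :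
    ∃ C : ℝ, 0 < C ∧ ∀ m : ℕ, 0 < m → ∀ x,
      (convPow F m).real (Ioc x (x + 1)) ≤ C / √m := by
  obtain ⟨δ, c, hδ, hδ1, hc, h⟩ := exists_norm_charFun_sq_le F hF
  refine ⟨4 * √(Real.pi / (c / 2)), by positivity, fun m hm x => ?_⟩
  have hpow : ∀ m t, charFun (convPow F m) t = charFun F t ^ m := fun m t => by
    induction m with
    | zero => simp [convPow]
    | succ m ih => rw [convPow, charFun_conv, ih, pow_succ]
  have hm' : (0 : ℝ) < m := by exact_mod_cast hm
  have hb : 0 < m * (c / 2) := by positivity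
  have hbound : ∀ t : ℝ, |t| ≤ 1 →
      ‖charFun (convPow F m) (δ * t)‖ ≤ Real.exp (-(m * (c / 2)) * t ^ 2) := by
    intro t ht
    have h1 : ‖charFun F (δ * t)‖ ≤ Real.exp (-(c / 2) * t ^ 2) := by
      refine abs_le_of_sq_le_sq' ?_ (Real.exp_pos _).le |>.2
      rw [← Real.exp_nat_mul]
      refine (h t ht).trans ((Real.one_sub_le_exp_neg _).trans_eq ?_)
      push_cast
      ring_nf
    rw [hpow, norm_pow]
    refine (pow_le_pow_left₀ (norm_nonneg _) h1 m).trans_eq ?_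
    rw [← Real.exp_nat_mul]
    ring_nf
  have hint := integrable_exp_neg_mul_sq hb
  have hint' := hint.mono_measure triangleLaw_le_volume
  calc (convPow F m).real (Ioc x (x + 1))
      ≤ 4 * ∫ t, ‖charFun (convPow F m) (δ * t)‖ ∂triangleLaw :=
        measureReal_Ioc_le_integral_norm_charFun _ hδ hδ1 x
    _ ≤ 4 * ∫ t, Real.exp (-(m * (c / 2)) * t ^ 2) ∂triangleLaw := by
        gcongr 4 * ?_
        refine integral_mono_of_nonneg (ae_of_all _ fun t => norm_nonneg _) hint' ?_
        filter_upwards [ae_triangleLaw_abs_le] with t ht using hbound t ht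
    _ ≤ 4 * ∫ t, Real.exp (-(m * (c / 2)) * t ^ 2) := by
        gcongr 4 * ?_
        exact integral_mono_measure triangleLaw_le_volume
          (ae_of_all _ fun t => (Real.exp_pos _).le) hint
    _ = 4 * √(Real.pi / (c / 2)) / √m := by
        rw [integral_gaussian, mul_div_assoc, ← Real.sqrt_div' _ hm'.le, div_div, mul_comm (c / 2)]

/-! ### Tail equivalence and convolution -/

theorem TailEquiv.symm {F L : Measure ℝ} (h : TailEquiv F L) : TailEquiv L F :=
  ⟨h.2.1, h.1, by simpa using h.2.2.inv₀ one_ne_zero⟩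

theorem TailEquiv.trans {F L M : Measure ℝ} (h₁ : TailEquiv F L) (h₂ : TailEquiv L M) :
    TailEquiv F M := by
  refine ⟨h₁.1, h₂.2.1, ?_⟩
  have h := h₁.2.2.mul h₂.2.2
  rw [mul_one] at h
  exact h.congr fun x => div_mul_div_cancel₀ (h₁.2.1 x).ne'

theorem TailEquiv.isLongTailed {F L : Measure ℝ} (h : TailEquiv L F) (hF : IsLongTailed F) :
    IsLongTailed L := by
  refine ⟨h.1, ?_⟩
  have h₁ := ((h.2.2.comp (tendsto_atTop_add_const_right atTop 1 tendsto_id)).mul hF.2).mul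
    h.symm.2.2
  simp only [mul_one] at h₁
  refine h₁.congr fun x => ?_
  simp only [Function.comp, id]
  rw [div_mul_div_cancel₀ (hF.1 _).ne', div_mul_div_cancel₀ (hF.1 _).ne']

theorem TailEquiv.eventually_Ioi_le {F L : Measure ℝ} [IsFiniteMeasure F] [IsFiniteMeasure L]
    (h : TailEquiv F L) {ε : ℝ} (hε : 0 < ε) :
    ∀ᶠ u : ℝ in atTop, F (Ioi u) ≤ ENNReal.ofReal (1 + ε) * L (Ioi u) := by
  filter_upwards [h.2.2.eventually_lt_const (by linarith : (1 : ℝ) < 1 + ε)] with u hu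
  rw [div_lt_iff₀ (h.2.1 u)] at hu
  rw [← ofReal_tail, ← ofReal_tail, ← ENNReal.ofReal_mul (by linarith)]
  exact ENNReal.ofReal_le_ofReal hu.le

theorem exists_one_le_mul_Ioi (F : Measure ℝ) [IsProbabilityMeasure F] {ε : ℝ} (hε : 0 < ε) :
    ∃ B : ℝ, ∀ u ≤ -B, 1 ≤ ENNReal.ofReal (1 + ε) * F (Ioi u) := by
  have hU : (⋃ n : ℕ, Ioi (-(n : ℝ))) = univ := by
    refine eq_univ_of_forall fun x => mem_iUnion.2 ?_
    obtain ⟨n, hn⟩ := exists_nat_gt (-x)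
    exact ⟨n, by simp only [mem_Ioi]; linarith⟩
  have hmono : Monotone fun n : ℕ => Ioi (-(n : ℝ)) := fun a b hab =>
    Ioi_subset_Ioi (neg_le_neg (by exact_mod_cast hab))
  have h := tendsto_measure_iUnion_atTop (μ := F) hmono
  rw [hU, measure_univ] at h
  have h1 : (ENNReal.ofReal (1 + ε))⁻¹ < 1 := by
    rw [ENNReal.inv_lt_one, ENNReal.one_lt_ofReal]
    linarith
  obtain ⟨n, hn⟩ := (h.eventually_const_lt h1).exists
  refine ⟨n, fun u hu => ?_⟩
  have h2 := hn.le.trans (measure_mono (Ioi_subset_Ioi hu))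
  rwa [ENNReal.inv_le_iff_le_mul (by simp) (by simp)] at h2

/-- If the tails of `L` and `F` are equivalent, then `L((u, ∞)) ≤ (1 + ε) F((u, ∞))` for all `u`
outside a bounded interval: for large `u` by equivalence, for very negative `u` because both tails
are close to `1`. Integrating over `u = x - y` leaves a bounded window as the error term. -/
theorem TailEquiv.exists_conv_Ioi_le {F L : Measure ℝ} [IsProbabilityMeasure F]
    [IsProbabilityMeasure L] (h : TailEquiv L F) {ε : ℝ} (hε : 0 < ε) :
    ∃ A B : ℝ, ∀ (K : Measure ℝ) [IsProbabilityMeasure K] (x : ℝ),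
      (L.conv K) (Ioi x) ≤
        ENNReal.ofReal (1 + ε) * (F.conv K) (Ioi x) + K (Ioc (x + -A) (x + B)) := by
  obtain ⟨A, hA⟩ := eventually_atTop.1 (h.eventually_Ioi_le hε)
  obtain ⟨B, hB⟩ := exists_one_le_mul_Ioi F hε
  refine ⟨A, B, fun K _ x => ?_⟩
  rw [conv_Ioi, conv_Ioi, ← lintegral_const_mul' _ _ ENNReal.ofReal_ne_top,
    ← lintegral_indicator_one measurableSet_Ioc,
    ← lintegral_add_right _ (measurable_one.indicator measurableSet_Ioc)]
  refine lintegral_mono fun y => ?_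
  by_cases h1 : A ≤ x - y
  · exact (hA _ h1).trans le_self_add
  by_cases h2 : x - y ≤ -B
  · exact (prob_le_one.trans (hB _ h2)).trans le_self_add
  · refine le_add_of_nonneg_of_le zero_le ?_
    have hy : y ∈ Ioc (x + -A) (x + B) := ⟨by linarith, by linarith⟩
    rw [indicator_of_mem hy]
    exact prob_le_one

theorem TailEquiv.of_eventually_le {H K : Measure ℝ} (hH : ∀ x, 0 < tail H x)
    (hK : ∀ x, 0 < tail K x)
    (h : ∀ ε : ℝ, 0 < ε → ∀ᶠ x in atTop, tail H x ≤ (1 + ε) * tail K x + ε * tail K x ∧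
      tail K x ≤ (1 + ε) * tail H x + ε * tail K x) : TailEquiv H K := by
  refine ⟨hH, hK, ?_⟩
  rw [Metric.tendsto_nhds]
  intro ε hε
  set η := min (ε / 8) 1
  have h1 : η ≤ 1 := min_le_right _ _
  have h2 : η ≤ ε / 8 := min_le_left _ _
  have h0 : 0 < η := by positivity
  filter_upwards [h η h0] with x hx
  have hk := hK x
  rw [Real.dist_eq, div_sub_one hk.ne', abs_div, abs_of_pos hk, div_lt_iff₀ hk, abs_lt]
  have h3 : η * tail H x ≤ 3 * (η * tail K x) := by
    have : tail H x ≤ 3 * tail K x := by nlinarith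
    nlinarith
  have h4 : η * tail K x ≤ ε / 8 * tail K x := by gcongr
  have h5 := mul_pos hε hk
  constructor <;> nlinarith

/-- Replacing a summand by a tail-equivalent one does not change the tail asymptotically, provided
that the sum is long-tailed. The summands themselves need not be long-tailed. -/
theorem TailEquiv.conv {F L K : Measure ℝ} [IsProbabilityMeasure F] [IsProbabilityMeasure L]
    [IsProbabilityMeasure K] (h : TailEquiv L F) (hFK : IsLongTailed (F.conv K)) :
    TailEquiv (L.conv K) (F.conv K) := by
  refine .of_eventually_le (fun x => ?_) hFK.1 fun ε hε => ?_
  · exact (tail_pos_iff _ x).2 (conv_Ioi_ne_zero (fun x => (tail_pos_iff L x).1 (h.1 x)) x)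
  obtain ⟨A, B, h1⟩ := h.exists_conv_Ioi_le hε
  obtain ⟨A', B', h2⟩ := h.symm.exists_conv_Ioi_le hε
  have hKF : IsLongTailed (K.conv F) := by rwa [Measure.conv_comm]
  have hε0 : ENNReal.ofReal ε ≠ 0 := by simpa using hε
  filter_upwards [hKF.eventually_Ioc_le_of_conv (-A) B hε0,
    hKF.eventually_Ioc_le_of_conv (-A') B' hε0] with x hx hx'
  rw [Measure.conv_comm K F] at hx hx'
  have e1 := (h1 K x).trans (add_le_add_right hx _)
  have e2 := (h2 K x).trans (add_le_add_right hx' _)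
  have nn : ∀ M : Measure ℝ, 0 ≤ tail M x := fun M => tail_nonneg M x
  have n1 : 0 ≤ 1 + ε := by linarith
  simp only [← ofReal_tail] at e1 e2
  rw [← ENNReal.ofReal_mul n1, ← ENNReal.ofReal_mul hε.le, ← ENNReal.ofReal_add
    (mul_nonneg n1 (nn _)) (mul_nonneg hε.le (nn _)), ENNReal.ofReal_le_ofReal_iff
    (add_nonneg (mul_nonneg n1 (nn _)) (mul_nonneg hε.le (nn _)))] at e1 e2
  exact ⟨e1, e2⟩

theorem convPow_two (F : Measure ℝ) [SFinite F] : convPow F 2 = F.conv F := by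
  simp [convPow]

theorem TailEquiv.convPow_two {F L : Measure ℝ} [IsProbabilityMeasure F] [IsProbabilityMeasure L]
    (h : TailEquiv L F) (hF : IsLongTailed (convPow F 2)) :
    TailEquiv (convPow L 2) (convPow F 2) := by
  rw [LongTail.convPow_two] at hF
  rw [LongTail.convPow_two, LongTail.convPow_two]
  have h1 : TailEquiv (L.conv F) (F.conv F) := h.conv hF
  have h2 : IsLongTailed (F.conv L) := by
    rw [Measure.conv_comm]
    exact h1.isLongTailed hF
  have h3 : TailEquiv (L.conv L) (F.conv L) := h.conv h2
  rw [Measure.conv_comm F L] at h3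
  exact h3.trans h1

/-! ### Compound distributions -/

theorem ae_le_of_measure_Ioi_eq_zero {α : Type*} [LinearOrder α] [MeasurableSpace α]
    {μ : Measure α} {a : α} (h : μ (Ioi a) = 0) : ∀ᵐ y ∂μ, y ≤ a :=
  measure_mono_null (fun _ hy => not_le.1 hy) h

section Compound

variable {Ω : Type*} [MeasurableSpace Ω] {F : Measure ℝ} {P : Measure Ω} {τ : Ω → ℕ}

theorem compound_apply (hτ : Measurable τ) {s : Set ℝ} (hs : MeasurableSet s) :
    compound F P τ s = ∫⁻ k, convPow F k s ∂(P.map τ) := by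
  rw [compound, Measure.sum_apply _ hs, lintegral_countable']
  refine tsum_congr fun k => ?_
  rw [Measure.smul_apply, smul_eq_mul, mul_comm, Measure.map_apply hτ (measurableSet_singleton k)]
  rfl

theorem isProbabilityMeasure_compound [IsProbabilityMeasure F] [IsProbabilityMeasure P]
    (hτ : Measurable τ) : IsProbabilityMeasure (compound F P τ) := by
  have := Measure.isProbabilityMeasure_map (μ := P) hτ.aemeasurable
  exact ⟨by simp [compound_apply hτ MeasurableSet.univ]⟩

theorem convPow_le_inv_mul_compound [IsFiniteMeasure P] {n : ℕ} (hn : P {ω | τ ω = n} ≠ 0)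
    {s : Set ℝ} (hs : MeasurableSet s) :
    convPow F n s ≤ (P {ω | τ ω = n})⁻¹ * compound F P τ s := by
  rw [← ENNReal.mul_le_iff_le_inv hn (measure_ne_top _ _), compound, Measure.sum_apply _ hs]
  exact ENNReal.le_tsum (f := fun k => (P {ω | τ ω = k} • convPow F k) s) n

variable [IsProbabilityMeasure F] [IsProbabilityMeasure P]

theorem IsLongTailed.eventually_convPow_Ioc_le {n : ℕ} (h : IsLongTailed (convPow F n))
    {ε : ℝ≥0∞} (hε : ε ≠ 0) :
    ∀ᶠ x : ℝ in atTop, ∀ k ≤ n, convPow F k (Ioc x (x + 1)) ≤ ε * convPow F n (Ioi x) := by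
  refine (eventually_all_finite (finite_Iic n)).2 fun k hk => ?_
  rw [convPow_eq_conv_sub F hk] at h ⊢
  exact h.negligibleIncrements_of_conv ε hε

theorem exists_compound_Ioi_add_le (hτ : Measurable τ) {n : ℕ} (hn : P.map τ (Ioi n) = 0) :
    ∃ (c : ℝ) (C : ℝ≥0∞), C ≠ ∞ ∧
      ∀ x, compound F P τ (Ioi (x + c)) ≤ C * convPow F n (Ioi x) := by
  have := Measure.isProbabilityMeasure_map (μ := P) hτ.aemeasurable
  have h : ∀ k, ∃ (c : ℝ) (C : ℝ≥0∞), C ≠ ∞ ∧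
      (k ≤ n → ∀ x, convPow F k (Ioi (x + c)) ≤ C * convPow F n (Ioi x)) := by
    intro k
    by_cases hk : k ≤ n
    · obtain ⟨c, C, hC, h⟩ := exists_measure_Ioi_add_le (convPow F k) (convPow F (n - k))
      rw [← convPow_eq_conv_sub F hk] at h
      exact ⟨c, C, hC, fun _ => h⟩
    · exact ⟨0, 0, ENNReal.zero_ne_top, fun h => absurd h hk⟩
  choose c C hC h using h
  refine ⟨∑ k ∈ Finset.range (n + 1), |c k|, ∑ k ∈ Finset.range (n + 1), C k,
    ENNReal.sum_ne_top.2 fun k _ => hC k, fun x => ?_⟩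
  have hae : ∀ᵐ k ∂(P.map τ), k ≤ n := ae_le_of_measure_Ioi_eq_zero hn
  rw [compound_apply hτ measurableSet_Ioi]
  refine (lintegral_mono_ae (g := fun _ => (∑ k ∈ Finset.range (n + 1), C k) *
    convPow F n (Ioi x)) ?_).trans_eq (by simp)
  filter_upwards [hae] with k hk
  have hk' : k ∈ Finset.range (n + 1) := Finset.mem_range.2 (by omega)
  refine (measure_mono (Ioi_subset_Ioi ?_)).trans ((h k hk x).trans ?_)
  · have := Finset.single_le_sum (f := fun k => |c k|) (fun i _ => abs_nonneg _) hk'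
    have := le_abs_self (c k)
    linarith
  · gcongr
    exact Finset.single_le_sum (f := C) (fun i _ => zero_le) hk'

theorem exists_convPow_Ioi_add_le_compound {n : ℕ}
    (hn : P {ω | n ≤ τ ω} ≠ 0) :
    ∃ (c : ℝ) (C : ℝ≥0∞), C ≠ ∞ ∧
      ∀ x, convPow F n (Ioi (x + c)) ≤ C * compound F P τ (Ioi x) := by
  obtain ⟨k, hk, hkp⟩ : ∃ k, n ≤ k ∧ P {ω | τ ω = k} ≠ 0 := by
    by_contra! h
    refine hn (measure_mono_null (t := ⋃ k ∈ Ici n, {ω | τ ω = k}) (fun ω hω => ?_) ?_)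
    · simpa using hω
    · exact (measure_biUnion_null_iff (to_countable _)).2 fun k hk => h k hk
  obtain ⟨c, C, hC, h⟩ := exists_measure_Ioi_add_le (convPow F n) (convPow F (k - n))
  rw [← convPow_eq_conv_sub F hk] at h
  refine ⟨c, C * (P {ω | τ ω = k})⁻¹, ENNReal.mul_ne_top hC (ENNReal.inv_ne_top.2 hkp),
    fun x => (h x).trans ?_⟩
  rw [mul_assoc]
  gcongr
  exact convPow_le_inv_mul_compound hkp measurableSet_Ioi

theorem IsLongTailed.exists_eventually_convPow_Ioi_le_compound {n : ℕ}
    (h : IsLongTailed (convPow F n)) (hn : P {ω | n ≤ τ ω} ≠ 0) :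
    ∃ C : ℝ≥0∞, C ≠ ∞ ∧
      ∀ᶠ x in atTop, convPow F n (Ioi x) ≤ C * compound F P τ (Ioi x) := by
  obtain ⟨c, C, hC, hcC⟩ := exists_convPow_Ioi_add_le_compound (F := F) hn
  refine ⟨2 * C, ENNReal.mul_ne_top ENNReal.ofNat_ne_top hC, ?_⟩
  filter_upwards [h.eventually_Ioi_le c] with x hx
  rw [mul_assoc]
  exact hx.trans (mul_le_mul_right (hcC x) _)

theorem compound_Ioi_ne_zero {n : ℕ} (h : IsLongTailed (convPow F n))
    (hn : P {ω | n ≤ τ ω} ≠ 0) (x : ℝ) :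
    compound F P τ (Ioi x) ≠ 0 := by
  obtain ⟨c, C, -, hcC⟩ := exists_convPow_Ioi_add_le_compound (F := F) hn
  exact fun h0 => ((isLongTailed_iff _).1 h).1 (x + c) (by simpa [h0] using hcC x)

theorem IsLongTailed.compound_of_bounded (hτ : Measurable τ) {n : ℕ}
    (h : IsLongTailed (convPow F n)) (hn : P {ω | n ≤ τ ω} ≠ 0) (hn' : P.map τ (Ioi n) = 0) :
    IsLongTailed (compound F P τ) := by
  have := isProbabilityMeasure_compound (F := F) (P := P) hτ
  have := Measure.isProbabilityMeasure_map (μ := P) hτ.aemeasurable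
  obtain ⟨C, hC, hcC⟩ := h.exists_eventually_convPow_Ioi_le_compound hn
  refine (isLongTailed_iff _).2 ⟨compound_Ioi_ne_zero h hn,
    NegligibleIncrements.mono hC (K := convPow F n) (fun ε hε => ?_) hcC⟩
  have hae : ∀ᵐ k ∂(P.map τ), k ≤ n := ae_le_of_measure_Ioi_eq_zero hn'
  filter_upwards [h.eventually_convPow_Ioc_le hε] with x hx
  rw [compound_apply hτ measurableSet_Ioc]
  refine (lintegral_mono_ae (g := fun _ => ε * convPow F n (Ioi x)) ?_).trans_eq (by simp)
  filter_upwards [hae] with k hk using hx k hk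

theorem IsLongTailed.convPow_of_compound (hτ : Measurable τ) {n : ℕ}
    (h : IsLongTailed (compound F P τ)) (hn : P {ω | τ ω = n} ≠ 0) (hn' : P.map τ (Ioi n) = 0) :
    IsLongTailed (convPow F n) := by
  have := isProbabilityMeasure_compound (F := F) (P := P) hτ
  obtain ⟨c, C, hC, hcC⟩ := exists_compound_Ioi_add_le (F := F) hτ hn'
  -- Long-tailedness absorbs the shift `c`: the compound tail is at most a multiple of the unshifted
  -- tail of `F^{*n}`.
  have h1 : NegligibleIncrements (compound F P τ) (convPow F n) := by
    refine ((isLongTailed_iff _).1 h).2.mono (C := 2 * C)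
      (ENNReal.mul_ne_top ENNReal.ofNat_ne_top hC) ?_
    filter_upwards [h.eventually_Ioi_le c] with x hx
    rw [mul_assoc]
    exact hx.trans (mul_le_mul_right (hcC x) _)
  refine (isLongTailed_iff _).2 ⟨fun x h0 => ?_, fun ε hε => ?_⟩
  · exact ((isLongTailed_iff _).1 h).1 (x + c) (by simpa [h0] using hcC x)
  · filter_upwards [h1 (P {ω | τ ω = n} * ε) (mul_ne_zero hn hε)] with x hx
    refine (convPow_le_inv_mul_compound hn measurableSet_Ioc).trans ?_
    rwa [ENNReal.inv_mul_le_iff hn (measure_ne_top _ _), ← mul_assoc]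

theorem convPow_Ioi_eq_zero {a : ℝ} (h : F (Ioi a) = 0) (n : ℕ) :
    convPow F n (Ioi (n * a)) = 0 := by
  induction n with
  | zero => simp [convPow]
  | succ n ih =>
    rw [convPow, conv_Ioi]
    refine lintegral_eq_zero_of_ae_eq_zero ?_
    have hae : ∀ᵐ y ∂F, y ≤ a := ae_le_of_measure_Ioi_eq_zero h
    filter_upwards [hae] with y hy
    refine measure_mono_null (Ioi_subset_Ioi ?_) ih
    push_cast
    linarith

/-- The terms of order `k > a * x` of the compound distribution: by concentration each of them gives
`(x, x + 1]` a mass of order `x ^ (-1/2)` at most. -/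
theorem eventually_setLIntegral_convPow_Ioc_le (hτ : Measurable τ) {n : ℕ}
    (h : IsLongTailed (convPow F n)) {a : ℝ} (ha : 0 < a)
    (hG : Tendsto (fun x : ℝ => P.real {ω | a * x < (τ ω : ℝ)} /
      (x ^ (1 / 2 : ℝ) * tail (convPow F n) x)) atTop (𝓝 0))
    {ε : ℝ≥0∞} (hε : ε ≠ 0) (hε' : ε ≠ ∞) :
    ∀ᶠ x : ℝ in atTop, ∫⁻ k in {k : ℕ | a * x < k}, convPow F k (Ioc x (x + 1)) ∂(P.map τ) ≤
      ε * convPow F n (Ioi x) := by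
  have hF : ∀ x, F (Ioi x) ≠ 0 := fun x h0 =>
    ((isLongTailed_iff _).1 h).1 (n * x) (convPow_Ioi_eq_zero h0 n)
  obtain ⟨C, hC, hCb⟩ := exists_convPow_Ioc_le_div_sqrt F hF
  have hε0 : 0 < ε.toReal := ENNReal.toReal_pos hε hε'
  filter_upwards [hG.eventually_lt_const (show 0 < ε.toReal * √a / C by positivity),
    eventually_gt_atTop 0] with x hx hx0
  have hax : 0 < a * x := mul_pos ha hx0
  have ht : 0 < tail (convPow F n) x := h.1 x
  rw [div_lt_iff₀ (by positivity), ← Real.sqrt_eq_rpow] at hx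
  have hset : P.map τ {k : ℕ | a * x < k} = ENNReal.ofReal (P.real {ω | a * x < (τ ω : ℝ)}) := by
    rw [Measure.map_apply hτ (MeasurableSet.of_discrete), ofReal_measureReal]
    rfl
  calc ∫⁻ k in {k : ℕ | a * x < k}, convPow F k (Ioc x (x + 1)) ∂(P.map τ)
      ≤ ∫⁻ _ in {k : ℕ | a * x < k}, ENNReal.ofReal (C / √(a * x)) ∂(P.map τ) := by
        refine setLIntegral_mono' MeasurableSet.of_discrete fun k hk => ?_
        have hk' : a * x < k := hk
        rw [← ofReal_measureReal (μ := convPow F k)]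
        refine ENNReal.ofReal_le_ofReal ((hCb k (by exact_mod_cast hax.trans hk') x).trans ?_)
        gcongr
    _ = ENNReal.ofReal (C / √(a * x) * P.real {ω | a * x < (τ ω : ℝ)}) := by
        rw [setLIntegral_const, hset, ENNReal.ofReal_mul (by positivity)]
    _ ≤ ENNReal.ofReal (ε.toReal * tail (convPow F n) x) := by
        refine ENNReal.ofReal_le_ofReal ?_
        calc C / √(a * x) * P.real {ω | a * x < (τ ω : ℝ)}
            ≤ C / √(a * x) * (ε.toReal * √a / C * (√x * tail (convPow F n) x)) := by gcongr
          _ = ε.toReal * tail (convPow F n) x := by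
              rw [Real.sqrt_mul ha.le]
              have := Real.sqrt_pos.2 ha
              have := Real.sqrt_pos.2 hx0
              field_simp
    _ = ε * convPow F n (Ioi x) := by
        rw [ENNReal.ofReal_mul hε0.le, ENNReal.ofReal_toReal hε', ofReal_tail]

theorem IsLongTailed.compound_of_tendsto (hτ : Measurable τ) {n : ℕ} (hn1 : 1 ≤ n)
    (h : IsLongTailed (convPow F n)) (hn : P {ω | n ≤ τ ω} ≠ 0)
    (hG : ∀ a : ℝ, 0 < a → Tendsto (fun x : ℝ => P.real {ω | a * x < (τ ω : ℝ)} /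
      (x ^ (1 / 2 : ℝ) * tail (convPow F n) x)) atTop (𝓝 0)) :
    IsLongTailed (compound F P τ) := by
  have := isProbabilityMeasure_compound (F := F) (P := P) hτ
  have := Measure.isProbabilityMeasure_map (μ := P) hτ.aemeasurable
  obtain ⟨C, hC, hcC⟩ := h.exists_eventually_convPow_Ioi_le_compound hn
  refine (isLongTailed_iff _).2 ⟨compound_Ioi_ne_zero h hn, fun ε hε => ?_⟩
  have hC' : C + 1 + C ≠ ∞ := by simp [hC]
  set η := min 1 (ε / (C + 1 + C))
  have hη : η ≠ 0 := (lt_min one_pos (ENNReal.div_pos hε hC')).ne'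
  have hη' : η ≠ ∞ := ((min_le_left _ _).trans_lt ENNReal.one_lt_top).ne
  obtain ⟨A, hA, hslow⟩ := h.exists_slowTail_convPow hn1 hη hη'
  -- The threshold `k * A` of the `k`-th power is at most `x` exactly for `k ≤ A⁻¹ * x`.
  filter_upwards [hcC, h.eventually_convPow_Ioc_le hη,
    eventually_setLIntegral_convPow_Ioc_le hτ h (inv_pos.2 hA) (hG _ (inv_pos.2 hA)) hη hη']
    with x hx hlow hhigh
  set s₁ : Set ℕ := Iio n
  set s₂ : Set ℕ := {k | n ≤ k ∧ (k : ℝ) ≤ A⁻¹ * x}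
  set s₃ : Set ℕ := {k | A⁻¹ * x < k}
  have hcover : s₁ ∪ s₂ ∪ s₃ = univ := by
    refine eq_univ_of_forall fun k => ?_
    rcases lt_or_ge k n with hk | hk
    · exact Or.inl (Or.inl hk)
    rcases le_or_gt (k : ℝ) (A⁻¹ * x) with hk' | hk'
    · exact Or.inl (Or.inr ⟨hk, hk'⟩)
    · exact Or.inr hk'
  have i₁ : ∫⁻ k in s₁, convPow F k (Ioc x (x + 1)) ∂(P.map τ) ≤ η * convPow F n (Ioi x) := by
    refine (setLIntegral_mono' (s := s₁) (g := fun _ => η * convPow F n (Ioi x))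
      MeasurableSet.of_discrete fun k hk => hlow k (le_of_lt hk)).trans ?_
    rw [setLIntegral_const]
    exact mul_le_of_le_one_right (zero_le) prob_le_one
  have i₂ : ∫⁻ k in s₂, convPow F k (Ioc x (x + 1)) ∂(P.map τ) ≤ η * compound F P τ (Ioi x) := by
    rw [compound_apply hτ measurableSet_Ioi, ← lintegral_const_mul' _ _ hη']
    refine le_trans ?_ (setLIntegral_le_lintegral s₂ _)
    refine setLIntegral_mono' MeasurableSet.of_discrete fun k hk => hslow k hk.1 x ?_
    have := hk.2
    rwa [inv_mul_eq_div, le_div_iff₀ hA] at this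
  calc compound F P τ (Ioc x (x + 1))
      = ∫⁻ k in s₁ ∪ s₂ ∪ s₃, convPow F k (Ioc x (x + 1)) ∂(P.map τ) := by
        rw [hcover, Measure.restrict_univ, compound_apply hτ measurableSet_Ioc]
    _ ≤ η * convPow F n (Ioi x) + η * compound F P τ (Ioi x) + η * convPow F n (Ioi x) :=
        (lintegral_union_le _ _ _).trans
          (add_le_add ((lintegral_union_le _ _ _).trans (add_le_add i₁ i₂)) hhigh)
    _ ≤ η * (C * compound F P τ (Ioi x)) + η * compound F P τ (Ioi x) +
          η * (C * compound F P τ (Ioi x)) := by gcongr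
    _ = η * (C + 1 + C) * compound F P τ (Ioi x) := by ring
    _ ≤ ε * compound F P τ (Ioi x) := by
        gcongr
        calc η * (C + 1 + C) ≤ ε / (C + 1 + C) * (C + 1 + C) := by gcongr; exact min_le_right _ _
          _ ≤ ε := (mul_comm _ _).trans_le ENNReal.mul_div_le

theorem map_Ioi_eq_zero_of_sum_eq_one (hτ : Measurable τ) {n : ℕ}
    (h : (∑ k ∈ Finset.range (n + 1), P.real {ω | τ ω = k}) = 1) : P.map τ (Ioi n) = 0 := by
  have := Measure.isProbabilityMeasure_map (μ := P) hτ.aemeasurable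
  have h1 : (P.map τ).real (Finset.range (n + 1)) = 1 := by
    rw [← sum_measureReal_singleton, ← h]
    refine Finset.sum_congr rfl fun k _ => ?_
    rw [map_measureReal_apply hτ (measurableSet_singleton k)]
    rfl
  have h2 : ((Finset.range (n + 1) : Finset ℕ) : Set ℕ) = Iic n := by
    ext k
    simp
  rw [h2] at h1
  rw [← compl_Iic, prob_compl_eq_zero_iff measurableSet_Iic]
  rwa [measureReal_def, ENNReal.toReal_eq_one_iff] at h1

end Compound

end LongTail

theorem corollary2p1 (F : Measure ℝ) [IsProbabilityMeasure F]
    {Ω : Type*} [MeasurableSpace Ω] (P : Measure Ω) [IsProbabilityMeasure P]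
    (τ : Ω → ℕ) (hτ : Measurable τ) :
    (∀ n : ℕ, 1 ≤ n → LongTail.IsLongTailed (LongTail.convPow F n) →
      ∀ k : ℕ, n ≤ k → LongTail.IsLongTailed (LongTail.convPow F k)) ∧
    (∀ n : ℕ, 1 ≤ n →
      (∑ k ∈ Finset.range (n + 1), P.real {ω | τ ω = k}) = 1 → 0 < P.real {ω | τ ω = n} →
      (LongTail.IsLongTailed (LongTail.compound F P τ) ↔
        LongTail.IsLongTailed (LongTail.convPow F n))) ∧
    (∀ n : ℕ, 1 ≤ n → 0 < P.real {ω | n ≤ τ ω} →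
      LongTail.IsLongTailed (LongTail.convPow F n) →
      (∀ a : ℝ, 0 < a →
        Tendsto (fun x : ℝ => P.real {ω | a * x < (τ ω : ℝ)} /
          (x ^ (1 / 2 : ℝ) * LongTail.tail (LongTail.convPow F n) x)) atTop (𝓝 0)) →
      LongTail.IsLongTailed (LongTail.compound F P τ)) ∧
    (∀ L : Measure ℝ, IsProbabilityMeasure L →
      LongTail.IsLongTailed (LongTail.convPow F 2) → LongTail.TailEquiv F L →
      LongTail.TailEquiv (LongTail.convPow L 2) (LongTail.convPow F 2) ∧
        LongTail.IsLongTailed (LongTail.convPow L 2)) := by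
  refine ⟨fun n hn h k hk => h.convPow_of_le hn hk, fun n _ hsum hpn => ?_,
    fun n hn hpn h hG => ?_, fun L _ hF hFL => ?_⟩
  · have hpn' : P {ω | τ ω = n} ≠ 0 := fun h => by simp [measureReal_def, h] at hpn
    have hn' := LongTail.map_Ioi_eq_zero_of_sum_eq_one hτ hsum
    refine ⟨fun h => h.convPow_of_compound hτ hpn' hn', fun h => ?_⟩
    exact h.compound_of_bounded hτ
      (fun h0 => hpn' (measure_mono_null (fun _ hω => hω.ge) h0)) hn'
  · have hpn' : P {ω | n ≤ τ ω} ≠ 0 := fun h => by simp [measureReal_def, h] at hpn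
    exact h.compound_of_tendsto hτ hn hpn' hG
  · have h := hFL.symm.convPow_two hF
    exact ⟨h, h.isLongTailed hF⟩
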